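/- For positive integers $k$ and $n$, a family $\mathcal{F}$ of subsets of $[n]=\{1,\dots,n\}$ is called $k$-antichain saturated if $\mathcal{F}$ does not contain an antichain (a family of sets that are pairwise incomparable under inclusion) of size $k$, but for every $X\subseteq[n]$ with $X\notin\mathcal{F}$ the family $\mathcal{F}\cup\{X\}$ does contain an antichain of size $k$. Let $\mathrm{sat}^*(n,k)$ denote the smallest size of a $k$-antichain saturated family of subsets of $[n]$. Then there exist absolute constants $c_1,c_2>0$ such that for every integer $k\ge 4$ there is an $N=N(k)$ such that for all integers $n\ge N$, $$n(k-1)-c_1\,k\log k\;\le\;\mathrm{sat}^*(n,k)\;\le\;n(k-1)-c_2\,k\log k.$$ -/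

import Mathlib

/-- The family `F` of subsets of an `n`-element set contains an antichain of size `k`
(with respect to inclusion). -/
def ContainsAntichain {n : ℕ} (k : ℕ) (F : Finset (Finset (Fin n))) : Prop :=
  ∃ A : Finset (Finset (Fin n)), A ⊆ F ∧ A.card = k ∧
    IsAntichain (· ⊆ ·) (A : Set (Finset (Fin n)))

/-- `F` is `k`-antichain saturated: it contains no antichain of size `k`, but adding any
subset of the ground set that is not in `F` creates an antichain of size `k`. -/
def IsAntichainSaturated {n : ℕ} (k : ℕ) (F : Finset (Finset (Fin n))) : Prop :=
  ¬ ContainsAntichain k F ∧ ∀ X : Finset (Fin n), X ∉ F → ContainsAntichain k (insert X F)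

/-- The saturation number `sat*(n, k)`: the smallest size of a `k`-antichain saturated family of
subsets of an `n`-element set. For `1 ≤ k` such a family exists, see `satStar_isLeast`. -/
noncomputable def satStar (n k : ℕ) : ℕ :=
  sInf {m : ℕ | ∃ F : Finset (Finset (Fin n)), IsAntichainSaturated k F ∧ F.card = m}

/-- For `1 ≤ k`, the infimum defining `satStar n k` is an attained minimum. -/
theorem satStar_isLeast (n k : ℕ) (hk : 1 ≤ k) :
    IsLeast {m : ℕ | ∃ F : Finset (Finset (Fin n)), IsAntichainSaturated k F ∧ F.card = m}
      (satStar n k) := by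
  classical
  refine ⟨Nat.sInf_mem ?_, fun m hm => Nat.sInf_le hm⟩
  obtain ⟨F, hF, hmax⟩ := Finset.exists_max_image
    (Finset.univ.filter fun F : Finset (Finset (Fin n)) => ¬ ContainsAntichain k F)
    Finset.card ⟨∅, by
      simp only [Finset.mem_filter, Finset.mem_univ, true_and]
      rintro ⟨A, hA, hc, -⟩
      rw [Finset.subset_empty.mp hA, Finset.card_empty] at hc
      omega⟩
  simp only [Finset.mem_filter, Finset.mem_univ, true_and] at hF hmax
  refine ⟨F.card, F, ⟨hF, fun X hX => ?_⟩, rfl⟩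
  by_contra h
  have := hmax _ h
  rw [Finset.card_insert_of_notMem hX] at this
  omega

/-! Put `m = k - 1`. By Dilworth, a saturated family is a maximal union of `m` chains, and only the
levels near the two ends of the cube can have fewer than `m` members.

Lower bound. The core is `hasFullExtensions`: `m` disjoint chains that all start on level `a` and
end on level `b` can be replaced by `m` disjoint skipless chains covering all the sets used. The
proof is by induction on `m`. In a maximal counterexample all levels strictly between are deficient;
the case of fewer chains then forces every set between a member of level `a` and a member of level
`b` into the family, and two counts of covering pairs contradict each other. To apply this to a
saturated `F`, extra coordinates (`blowup`) prolong its chains so that they share their end levels.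
By saturation, any subset of the least member of a chain could join that chain, so `F` contains the
whole cube below that member; the width then makes this cube of dimension `O(log m)`, and dually at
the top. Hence each level outside two ranges of length `O(log m)` has `m` members
(`card_slice_of_saturated`).

Upper bound. Saturate an antichain of `m` sets in the middle level of a cube of dimension `2 * t`,
with `t` of order `log m`. Low levels of the result stay inside that small cube, so about `2 * t /
3` of them have at most `m / 2` members. -/

/-! ### Width, chain colourings and Dilworth's theorem. -/

section Dilworth

variable {P : Type*} [PartialOrder P]

/-- Every antichain contained in `F` has at most `m` elements. -/
def WidthLE (m : ℕ) (F : Finset P) : Prop :=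
  ∀ M ⊆ F, IsAntichain (· ≤ ·) (M : Set P) → M.card ≤ m

/-- `f` splits `F` into `m` chains, indexed by `0, …, m - 1`. -/
def IsChainColoring (m : ℕ) (F : Finset P) (f : P → ℕ) : Prop :=
  (∀ x ∈ F, f x < m) ∧ ∀ x ∈ F, ∀ y ∈ F, f x = f y → x ≤ y ∨ y ≤ x

theorem WidthLE.mono {m : ℕ} {F G : Finset P} (h : WidthLE m G) (hFG : F ⊆ G) : WidthLE m F :=
  fun M hM => h M (hM.trans hFG)

namespace IsChainColoring

variable {m : ℕ} {F : Finset P} {f : P → ℕ}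

theorem mono {G : Finset P} (h : IsChainColoring m F f) (hG : G ⊆ F) : IsChainColoring m G f :=
  ⟨fun x hx => h.1 x (hG hx), fun x hx y hy => h.2 x (hG hx) y (hG hy)⟩

theorem injOn (h : IsChainColoring m F f) {M : Finset P} (hM : M ⊆ F)
    (ha : IsAntichain (· ≤ ·) (M : Set P)) : Set.InjOn f M := by
  intro x hx y hy hxy
  by_contra hne
  rcases h.2 x (hM hx) y (hM hy) hxy with h1 | h1
  · exact ha hx hy hne h1
  · exact ha hy hx (Ne.symm hne) h1

theorem widthLE (h : IsChainColoring m F f) : WidthLE m F := by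
  intro M hM ha
  simpa using Finset.card_le_card_of_injOn (t := Finset.range m) f
    (fun x hx => by simpa using h.1 x (hM hx)) (h.injOn hM ha)

theorem exists_mem (h : IsChainColoring m F f) {M : Finset P} (hM : M ⊆ F)
    (ha : IsAntichain (· ≤ ·) (M : Set P)) (hc : m ≤ M.card) {i : ℕ} (hi : i < m) :
    ∃ x ∈ M, f x = i := by
  obtain ⟨x, hx, hxi⟩ := Finset.surj_on_of_inj_on_of_card_le (s := M) (t := Finset.range m)
    (fun x _ => f x) (fun x hx => by simpa using h.1 x (hM hx))
    (fun x y hx hy hxy => h.injOn hM ha hx hy hxy) (by simpa using hc) i (by simpa using hi)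
  exact ⟨x, hx, hxi.symm⟩

end IsChainColoring

theorem isAntichain_insert_of_incomp {M : Finset P} {z : P} [DecidableEq P]
    (ha : IsAntichain (· ≤ ·) (M : Set P)) (h : ∀ x ∈ M, ¬ x ≤ z ∧ ¬ z ≤ x) :
    IsAntichain (· ≤ ·) ((insert z M : Finset P) : Set P) := by
  rw [Finset.coe_insert]
  exact ha.insert (fun x hx _ => (h x hx).1) (fun x hx _ => (h x hx).2)

theorem WidthLE.comparable {m : ℕ} {F : Finset P} (h : WidthLE m F) {M : Finset P} (hM : M ⊆ F)
    (ha : IsAntichain (· ≤ ·) (M : Set P)) (hc : m ≤ M.card) {z : P} (hz : z ∈ F) :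
    ∃ x ∈ M, x ≤ z ∨ z ≤ x := by
  classical
  by_contra! hcon
  have h1 := h (insert z M) (Finset.insert_subset hz hM) (isAntichain_insert_of_incomp ha hcon)
  rw [Finset.card_insert_of_notMem (fun hzM => (hcon z hzM).1 le_rfl)] at h1
  omega

/-- Dilworth's theorem for a finite subset of a partial order. -/
theorem WidthLE.exists_isChainColoring {m : ℕ} {F : Finset P} (hF : WidthLE m F) :
    ∃ f : P → ℕ, IsChainColoring m F f := by
  classical
  induction hn : F.card using Nat.strong_induction_on generalizing F m with
  | _ n ih =>
  rcases F.eq_empty_or_nonempty with rfl | hne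
  · exact ⟨fun _ => 0, by simp, by simp⟩
  have hmpos : 0 < m := by
    obtain ⟨x, hx⟩ := hne
    exact Nat.lt_of_lt_of_le (by simp) (hF {x} (by simpa using hx) (by simp))
  obtain ⟨a, ha⟩ := F.exists_maximal hne
  have haF : a ∈ F := ha.1
  have hcard := Finset.card_erase_lt_of_mem haF
  by_cases hw : WidthLE (m - 1) (F.erase a)
  · obtain ⟨f, hf1, hf2⟩ := ih _ (by omega) hw rfl
    refine ⟨fun x => if x = a then m - 1 else f x, fun x hx => ?_, fun x hx y hy hxy => ?_⟩
    · dsimp only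
      split_ifs with h
      · omega
      · have := hf1 x (Finset.mem_erase.2 ⟨h, hx⟩); omega
    · dsimp only at hxy
      split_ifs at hxy with h1 h2 h2
      · left; rw [h1, h2]
      · have := hf1 y (Finset.mem_erase.2 ⟨h2, hy⟩); omega
      · have := hf1 x (Finset.mem_erase.2 ⟨h1, hx⟩); omega
      · exact hf2 x (Finset.mem_erase.2 ⟨h1, hx⟩) y (Finset.mem_erase.2 ⟨h2, hy⟩) hxy
  have hFa : WidthLE m (F.erase a) := hF.mono (Finset.erase_subset _ _)
  obtain ⟨f, hf⟩ := ih _ (by omega) hFa rfl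
  obtain ⟨M₀, hM₀, hM₀a, hM₀c⟩ : ∃ M ⊆ F.erase a, IsAntichain (· ≤ ·) (M : Set P) ∧
      m ≤ M.card := by
    simp only [WidthLE] at hw
    push Not at hw
    obtain ⟨M, h1, h2, h3⟩ := hw
    exact ⟨M, h1, h2, by omega⟩
  -- In each colour class take the highest element lying on an antichain of size `m`; these elements
  -- will form an antichain.
  have hx : ∀ i : Fin m, ∃ x ∈ F.erase a, f x = i ∧
      (∃ M ⊆ F.erase a, IsAntichain (· ≤ ·) (M : Set P) ∧ m ≤ M.card ∧ x ∈ M) ∧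
      ∀ y ∈ F.erase a, f y = i → (∃ M ⊆ F.erase a, IsAntichain (· ≤ ·) (M : Set P) ∧
        m ≤ M.card ∧ y ∈ M) → y ≤ x := by
    intro i
    obtain ⟨x₀, hx₀, hx₀i⟩ := hf.exists_mem hM₀ hM₀a hM₀c i.2
    obtain ⟨x, hx⟩ := ((F.erase a).filter fun x => f x = i ∧
      ∃ M ⊆ F.erase a, IsAntichain (· ≤ ·) (M : Set P) ∧ m ≤ M.card ∧ x ∈ M).exists_maximal
      ⟨x₀, by simp only [Finset.mem_filter]; exact ⟨hM₀ hx₀, hx₀i, M₀, hM₀, hM₀a, hM₀c, hx₀⟩⟩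
    have hx1 := hx.1
    simp only [Finset.mem_filter] at hx1
    refine ⟨x, hx1.1, hx1.2.1, hx1.2.2, fun y hy hyi hyM => ?_⟩
    rcases hf.2 y hy x hx1.1 (hyi.trans hx1.2.1.symm) with h | h
    · exact h
    · exact hx.2 (by simp only [Finset.mem_filter]; exact ⟨hy, hyi, hyM⟩) h
  choose x hxF hxi hxM hxmax using hx
  have hxinj : Function.Injective x := fun i j hij => by
    have := hxi i; rw [hij, hxi j] at this; exact Fin.ext this.symm
  have hA : IsAntichain (· ≤ ·) ((Finset.univ.image x : Finset P) : Set P) := by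
    intro u hu v hv huv hle
    simp only [Finset.coe_image, Finset.coe_univ, Set.image_univ, Set.mem_range] at hu hv
    obtain ⟨i, rfl⟩ := hu
    obtain ⟨j, rfl⟩ := hv
    obtain ⟨M, hM, hMa, hMc, hjM⟩ := hxM j
    obtain ⟨y, hy, hyi⟩ := hf.exists_mem hM hMa hMc i.2
    have hyx := hxmax i y (hM hy) hyi ⟨M, hM, hMa, hMc, hy⟩
    refine hMa hy hjM (fun h => huv ?_) (hyx.trans hle)
    rw [h, hxi j] at hyi
    rw [Fin.ext hyi]
  obtain ⟨i, hi⟩ : ∃ i, x i ≤ a := by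
    obtain ⟨u, hu, hu'⟩ := hF.comparable (M := Finset.univ.image x) (z := a)
      (fun u hu => by
        obtain ⟨i, -, rfl⟩ := Finset.mem_image.1 hu
        exact Finset.mem_of_mem_erase (hxF i)) hA
      (by rw [Finset.card_image_of_injective _ hxinj]; simp) haF
    obtain ⟨i, -, rfl⟩ := Finset.mem_image.1 hu
    refine ⟨i, hu'.elim id fun h => ha.2 (Finset.mem_of_mem_erase (hxF i)) h⟩
  -- The removed elements, together with `a`, form one chain through `x i`. An antichain of size `m`
  -- in the rest would contain an element of colour `i`, which lies below `x i` by the choice of `x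
  -- i`; so the width drops.
  set G := (F.erase a).filter fun z => ¬ (f z = i ∧ z ≤ x i) with hG
  have hGF : G ⊆ F.erase a := Finset.filter_subset _ _
  have hGw : WidthLE (m - 1) G := by
    intro M hM hMa
    by_contra hlt
    obtain ⟨y, hy, hyi⟩ := hf.exists_mem (hM.trans hGF) hMa (by omega) i.2
    exact (Finset.mem_filter.1 (hM hy)).2 ⟨hyi, hxmax i y (hGF (hM hy)) hyi
      ⟨M, hM.trans hGF, hMa, by omega, hy⟩⟩
  obtain ⟨g, hg1, hg2⟩ := ih _ (by have := Finset.card_le_card hGF; omega) hGw rfl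
  have hnG : ∀ z ∈ F, z ∉ G → z = a ∨ (z ∈ F.erase a ∧ f z = i ∧ z ≤ x i) := by
    intro z hz hzG
    by_cases hza : z = a
    · exact Or.inl hza
    · refine Or.inr ⟨Finset.mem_erase.2 ⟨hza, hz⟩, ?_⟩
      by_contra hcon
      exact hzG (Finset.mem_filter.2 ⟨Finset.mem_erase.2 ⟨hza, hz⟩, hcon⟩)
  refine ⟨fun z => if z ∈ G then g z else m - 1, fun z hz => ?_, fun z hz w hwF hzw => ?_⟩
  · dsimp only
    split_ifs with h
    · have := hg1 z h; omega
    · omega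
  · dsimp only at hzw
    split_ifs at hzw with h1 h2 h2
    · exact hg2 z h1 w h2 hzw
    · have := hg1 z h1; omega
    · have := hg1 w h2; omega
    · rcases hnG z hz h1 with rfl | ⟨hz1, hz2, hz3⟩ <;>
        rcases hnG w hwF h2 with rfl | ⟨hw1, hw2, hw3⟩
      · exact Or.inl le_rfl
      · exact Or.inr (hw3.trans hi)
      · exact Or.inl (hz3.trans hi)
      · exact hf.2 z hz1 w hw1 (hz2.trans hw2.symm)

theorem WidthLE.union [DecidableEq P] {m m' : ℕ} {F G : Finset P} (hF : WidthLE m F)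
    (hG : WidthLE m' G) : WidthLE (m + m') (F ∪ G) := by
  intro M hM ha
  have h1 := hF (M ∩ F) Finset.inter_subset_right (ha.subset (by simp))
  have h2 := hG (M \ F) (fun x hx => by
    have := Finset.mem_sdiff.1 hx
    exact (Finset.mem_union.1 (hM this.1)).resolve_left this.2)
    (ha.subset (by simp))
  have := Finset.card_inter_add_card_sdiff M F
  omega

end Dilworth

/-! ### Chain colourings and the levels of the cube. -/

section Levels

open Finset

variable {α : Type*}

theorem isAntichain_slice (F : Finset (Finset α)) (j : ℕ) :
    IsAntichain (· ≤ ·) ((F.slice j : Finset (Finset α)) : Set (Finset α)) :=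
  (sized_slice (𝒜 := F) (r := j)).isAntichain

theorem WidthLE.card_slice_le {m : ℕ} {F : Finset (Finset α)} (h : WidthLE m F) (j : ℕ) :
    (F.slice j).card ≤ m :=
  h _ slice_subset (isAntichain_slice F j)

theorem WidthLE.exists_slice_comparable {m : ℕ} {F : Finset (Finset α)} (h : WidthLE m F) {j : ℕ}
    (hj : (F.slice j).card = m) {z : Finset α} (hz : z ∈ F) :
    ∃ x ∈ F.slice j, (x ⊆ z ∨ z ⊆ x) :=
  h.comparable slice_subset (isAntichain_slice F j) hj.ge hz

theorem WidthLE.exists_slice_subset {m : ℕ} {F : Finset (Finset α)} (h : WidthLE m F) {j : ℕ}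
    (hj : (F.slice j).card = m) {z : Finset α} (hz : z ∈ F) (hjz : j ≤ z.card) :
    ∃ x ∈ F.slice j, x ⊆ z := by
  obtain ⟨x, hx, hxz | hzx⟩ := h.exists_slice_comparable hj hz
  · exact ⟨x, hx, hxz⟩
  · refine ⟨x, hx, (eq_of_subset_of_card_le hzx ?_).ge⟩
    rw [(mem_slice.1 hx).2]; exact hjz

theorem WidthLE.exists_slice_superset {m : ℕ} {F : Finset (Finset α)} (h : WidthLE m F) {j : ℕ}
    (hj : (F.slice j).card = m) {z : Finset α} (hz : z ∈ F) (hjz : z.card ≤ j) :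
    ∃ x ∈ F.slice j, z ⊆ x := by
  obtain ⟨x, hx, hxz | hzx⟩ := h.exists_slice_comparable hj hz
  · refine ⟨x, hx, (eq_of_subset_of_card_le hxz ?_).ge⟩
    rw [(mem_slice.1 hx).2]; exact hjz
  · exact ⟨x, hx, hzx⟩

namespace IsChainColoring

variable {m : ℕ} {F : Finset (Finset α)} {f : Finset α → ℕ}

theorem exists_mem_slice (h : IsChainColoring m F f) {j : ℕ} (hj : (F.slice j).card = m)
    {i : ℕ} (hi : i < m) : ∃ x ∈ F.slice j, f x = i :=
  h.exists_mem slice_subset (isAntichain_slice F j) hj.ge hi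

theorem subset_of_card_le (h : IsChainColoring m F f) {x y : Finset α} (hx : x ∈ F) (hy : y ∈ F)
    (hf : f x = f y) (hc : x.card ≤ y.card) : x ⊆ y := by
  rcases h.2 x hx y hy hf with h1 | h1
  · exact h1
  · exact (eq_of_subset_of_card_le h1 hc).ge

theorem eq_of_card_eq (h : IsChainColoring m F f) {x y : Finset α} (hx : x ∈ F) (hy : y ∈ F)
    (hf : f x = f y) (hc : x.card = y.card) : x = y :=
  (h.subset_of_card_le hx hy hf hc.le).antisymm (h.subset_of_card_le hy hx hf.symm hc.ge)

theorem card_filter_mem (h : IsChainColoring m F f) {M : Finset (Finset α)} (hM : M ⊆ F)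
    (ha : IsAntichain (· ≤ ·) (M : Set (Finset α))) (hc : m ≤ M.card) {I : Finset ℕ}
    (hI : I ⊆ range m) : (M.filter fun x => f x ∈ I).card = I.card := by
  classical
  rw [← card_image_of_injOn (f := f) (s := M.filter fun x => f x ∈ I)
    ((h.injOn hM ha).mono fun x hx => (mem_filter.1 hx).1)]
  congr 1
  ext i
  simp only [mem_image, mem_filter]
  constructor
  · rintro ⟨x, ⟨-, hx⟩, rfl⟩; exact hx
  · intro hi
    obtain ⟨x, hx, rfl⟩ := h.exists_mem hM ha hc (mem_range.1 (hI hi))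
    exact ⟨x, ⟨hx, hi⟩, rfl⟩

theorem widthLE_filter (h : IsChainColoring m F f) (I : Finset ℕ) :
    WidthLE I.card (F.filter fun x => f x ∈ I) := by
  intro M hM ha
  exact card_le_card_of_injOn f (fun x hx => (mem_filter.1 (hM hx)).2)
    (h.injOn (hM.trans (filter_subset _ _)) ha)

/-- Following the chains from level `j` to level `i`. -/
theorem exists_level_map (h : IsChainColoring m F f) {i j : ℕ} (hi : (F.slice i).card = m) :
    ∃ φ : Finset α → Finset α, (∀ V ∈ F.slice j, φ V ∈ F.slice i ∧ (i ≤ j → φ V ⊆ V) ∧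
      (j ≤ i → V ⊆ φ V)) ∧ Set.InjOn φ (F.slice j : Finset (Finset α)) := by
  have key : ∀ V, ∃ W, V ∈ F.slice j → (W ∈ F.slice i ∧ f W = f V) := by
    intro V
    by_cases hV : V ∈ F.slice j
    · obtain ⟨W, hW, hf⟩ := h.exists_mem_slice hi (h.1 V (mem_slice.1 hV).1)
      exact ⟨W, fun _ => ⟨hW, hf⟩⟩
    · exact ⟨V, fun h => absurd h hV⟩
  choose φ hφ using key
  refine ⟨φ, fun V hV => ?_, fun V hV W hW hVW => ?_⟩
  · obtain ⟨h1, h2⟩ := hφ V hV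
    rw [mem_slice] at hV
    refine ⟨h1, ?_, ?_⟩ <;> rw [mem_slice] at h1 <;> intro hle
    · exact h.subset_of_card_le h1.1 hV.1 h2 (by omega)
    · exact h.subset_of_card_le hV.1 h1.1 h2.symm (by omega)
  · have h1 := (hφ V hV).2
    have h2 := (hφ W hW).2
    have hV' := mem_slice.1 (mem_coe.1 hV)
    have hW' := mem_slice.1 (mem_coe.1 hW)
    exact h.eq_of_card_eq hV'.1 hW'.1 (by rw [← h1, ← h2, hVW]) (by omega)

end IsChainColoring

/-- Replacing the part of an antichain outside two full levels by elements of those levels. -/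
theorem WidthLE.insert_of_insert_filter [DecidableEq α] {m a b : ℕ} {F : Finset (Finset α)}
    (hF : WidthLE m F) (ha : (F.slice a).card = m) (hb : (F.slice b).card = m) (hab : a ≤ b)
    {Z : Finset α} (haZ : a ≤ Z.card) (hZb : Z.card ≤ b)
    (hZ : WidthLE m (insert Z (F.filter fun S => a ≤ S.card ∧ S.card ≤ b))) :
    WidthLE m (insert Z F) := by
  by_cases hZF : Z ∈ F
  · rwa [insert_eq_of_mem hZF]
  obtain ⟨f, hf⟩ := hF.exists_isChainColoring
  -- `y` is the projection of `x` to the window along its own chain: up to level `a`, down to level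
  -- `b`, or fixed. `Z` is fixed as well.
  have key : ∀ x, ∃ y, x ∈ insert Z F → (a ≤ y.card ∧ y.card ≤ b ∧ (x = Z → y = Z) ∧
      (x ≠ Z → y ∈ F ∧ f y = f x) ∧ (x ⊆ y ∨ y.card = b) ∧ (y ⊆ x ∨ y.card = a)) := by
    intro x
    by_cases hxZ : x = Z
    · exact ⟨Z, fun _ => ⟨haZ, hZb, fun _ => rfl, fun h => absurd hxZ h, Or.inl hxZ.le,
        Or.inl hxZ.ge⟩⟩
    by_cases hx : x ∈ F
    · rcases lt_or_ge x.card a with h1 | h1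
      · obtain ⟨y, hy, hyx⟩ := hf.exists_mem_slice ha (hf.1 x hx)
        rw [mem_slice] at hy
        exact ⟨y, fun _ => ⟨by omega, by omega, fun h => absurd h hxZ, fun _ => ⟨hy.1, hyx⟩,
          Or.inl (hf.subset_of_card_le hx hy.1 hyx.symm (by omega)), Or.inr hy.2⟩⟩
      rcases lt_or_ge b x.card with h2 | h2
      · obtain ⟨y, hy, hyx⟩ := hf.exists_mem_slice hb (hf.1 x hx)
        rw [mem_slice] at hy
        exact ⟨y, fun _ => ⟨by omega, by omega, fun h => absurd h hxZ, fun _ => ⟨hy.1, hyx⟩,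
          Or.inr hy.2, Or.inl (hf.subset_of_card_le hy.1 hx hyx (by omega))⟩⟩
      · exact ⟨x, fun _ => ⟨h1, h2, fun h => absurd h hxZ, fun _ => ⟨hx, rfl⟩,
          Or.inl subset_rfl, Or.inl subset_rfl⟩⟩
    · exact ⟨x, fun h => absurd (mem_insert.1 h) (by tauto)⟩
  choose p hp using key
  intro M hM hMa
  have hnot : ∀ x ∈ M, ∀ y ∈ M, x ≠ y → ¬ p x ⊆ p y := by
    intro x hx y hy hxy hsub
    obtain ⟨hx1, hx2, hx3, hx4, hx5, -⟩ := hp x (hM hx)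
    obtain ⟨hy1, hy2, hy3, hy4, -, hy6⟩ := hp y (hM hy)
    by_cases hgood : x ⊆ p x ∧ p y ⊆ y
    · exact hMa hx hy hxy (hgood.1.trans (hsub.trans hgood.2))
    -- Here `p x` is on level `b` or `p y` is on level `a`, so cardinality turns the inclusion into
    -- equality and `x`, `y` share a chain.
    have heq : p x = p y := by
      refine eq_of_subset_of_card_le hsub ?_
      rcases hx5 with h5 | h5
      · rcases hy6 with h6 | h6
        · exact absurd ⟨h5, h6⟩ hgood
        · omega
      · omega
    by_cases hxZ : x = Z
    · have hyZ : y ≠ Z := fun h => hxy (hxZ.trans h.symm)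
      exact hZF (by rw [← hx3 hxZ, heq]; exact (hy4 hyZ).1)
    by_cases hyZ : y = Z
    · exact hZF (by rw [← hy3 hyZ, ← heq]; exact (hx4 hxZ).1)
    have hxF := (mem_insert.1 (hM hx)).resolve_left hxZ
    have hyF := (mem_insert.1 (hM hy)).resolve_left hyZ
    rcases hf.2 x hxF y hyF (by rw [← (hx4 hxZ).2, ← (hy4 hyZ).2, heq]) with h | h
    · exact hMa hx hy hxy h
    · exact hMa hy hx hxy.symm h
  have hinj : Set.InjOn p (M : Set (Finset α)) := by
    intro x hx y hy hxy
    by_contra hne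
    exact hnot x hx y hy hne hxy.le
  rw [← card_image_of_injOn hinj]
  refine hZ _ (fun u hu => ?_) ?_
  · obtain ⟨x, hx, rfl⟩ := mem_image.1 hu
    obtain ⟨h1, h2, h3, h4, -, -⟩ := hp x (hM hx)
    by_cases hxZ : x = Z
    · rw [h3 hxZ]; exact mem_insert_self _ _
    · exact mem_insert_of_mem (mem_filter.2 ⟨(h4 hxZ).1, h1, h2⟩)
  · intro u hu v hv huv hle
    simp only [coe_image, Set.mem_image, mem_coe] at hu hv
    obtain ⟨x, hx, rfl⟩ := hu
    obtain ⟨y, hy, rfl⟩ := hv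
    exact hnot x hx y hy (fun h => huv (by rw [h])) hle

end Levels

/-! ### Double counting of covering pairs near two full levels. -/

section Counting

open Finset

variable {α : Type*} [DecidableEq α]

/-- If the whole region between the levels `a` and `b` of `F` belongs to `F`, then the upper degrees
drop strictly along `X ⊆ V`. -/
theorem card_superset_succ_le {F : Finset (Finset α)} {a b : ℕ} (hab : a + 2 ≤ b)
    (hfill : ∀ X ∈ F.slice a, ∀ B ∈ F.slice b, ∀ Z, X ⊆ Z → Z ⊆ B → a < Z.card → Z.card < b →
      Z ∈ F)
    {X V Y : Finset α} (hX : X ∈ F.slice a) (hV : V.card + 1 = b) (hXV : X ⊆ V)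
    (hY : Y ∈ F.slice b) (hVY : V ⊆ Y) :
    ((F.slice b).filter fun B => V ⊆ B).card + 1 ≤
      ((F.slice (a + 1)).filter fun U => X ⊆ U).card := by
  have hXa := (mem_slice.1 hX).2
  obtain ⟨s, hsV, hsX⟩ : ∃ s ∈ V, s ∉ X := by
    by_contra! hcon
    have := card_le_card (show V ⊆ X from hcon)
    omega
  have hUs : (insert s X).card = a + 1 := by rw [card_insert_of_notMem hsX, hXa]
  -- Each `B` in `D` adds one element to `V`; adding it to `X` instead gives distinct upper
  -- neighbours of `X`, and `s`, taken from `V`, gives one more.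
  set D := (F.slice b).filter fun B => V ⊆ B with hD
  have hDmem : ∀ B ∈ D, B ∈ F.slice b ∧ V ⊆ B := fun B hB => mem_filter.1 hB
  have hdiff : ∀ B ∈ D, (B \ V).card = 1 := fun B hB => by
    rw [card_sdiff_of_subset (hDmem B hB).2, (mem_slice.1 (hDmem B hB).1).2]; omega
  have hdisj : ∀ B, Disjoint X (B \ V) := fun B =>
    disjoint_left.2 fun x hx hx' => (mem_sdiff.1 hx').2 (hXV hx)
  have hnot : insert s X ∉ D.image fun B => X ∪ (B \ V) := by
    intro h
    obtain ⟨B, hB, hBe⟩ := mem_image.1 h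
    obtain ⟨t, ht⟩ := card_pos.1 (by rw [hdiff B hB]; omega : 0 < (B \ V).card)
    have htu : t ∈ insert s X := by rw [← hBe]; exact mem_union_right _ ht
    rcases mem_insert.1 htu with rfl | htX
    · exact (mem_sdiff.1 ht).2 hsV
    · exact (mem_sdiff.1 ht).2 (hXV htX)
  have hinj : Set.InjOn (fun B => X ∪ (B \ V)) (D : Set (Finset α)) := by
    intro B hB B' hB' h
    have h1 : ∀ B ∈ D, (X ∪ (B \ V)) ∪ V = B := fun B hB => by
      rw [union_assoc, sdiff_union_of_subset (hDmem B hB).2,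
        union_eq_right.2 (hXV.trans (hDmem B hB).2)]
    rw [← h1 B hB, ← h1 B' hB']
    exact congrArg (· ∪ V) h
  rw [← card_image_of_injOn hinj, ← card_insert_of_notMem hnot]
  refine card_le_card fun U hU => ?_
  rw [mem_filter, mem_slice]
  rcases mem_insert.1 hU with rfl | hU
  · refine ⟨⟨hfill X hX Y hY _ (subset_insert _ _) ?_ (by omega) (by omega), hUs⟩,
      subset_insert _ _⟩
    exact (insert_subset hsV hXV).trans hVY
  · obtain ⟨B, hB, rfl⟩ := mem_image.1 hU
    have hc : (X ∪ (B \ V)).card = a + 1 := by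
      rw [card_union_of_disjoint (hdisj B), hdiff B hB, hXa]
    refine ⟨⟨hfill X hX B (hDmem B hB).1 _ subset_union_left ?_ (by omega) (by omega), hc⟩,
      subset_union_left⟩
    exact union_subset (hXV.trans (hDmem B hB).2) sdiff_subset

/-- The dual of `card_superset_succ_le`: the lower degrees grow strictly along `U ⊆ Y`. -/
theorem card_subset_succ_le {F : Finset (Finset α)} {a b : ℕ} (hab : a + 2 ≤ b)
    (hfill : ∀ X ∈ F.slice a, ∀ B ∈ F.slice b, ∀ Z, X ⊆ Z → Z ⊆ B → a < Z.card → Z.card < b →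
      Z ∈ F)
    {X U Y : Finset α} (hX : X ∈ F.slice a) (hU : U.card = a + 1) (hXU : X ⊆ U)
    (hY : Y ∈ F.slice b) (hUY : U ⊆ Y) :
    ((F.slice a).filter fun A => A ⊆ U).card + 1 ≤
      ((F.slice (b - 1)).filter fun V => V ⊆ Y).card := by
  have hYb := (mem_slice.1 hY).2
  obtain ⟨s, hsY, hsU⟩ : ∃ s ∈ Y, s ∉ U := by
    by_contra! hcon
    have := card_le_card (show Y ⊆ U from hcon)
    omega
  have hVs : (Y.erase s).card = b - 1 := by rw [card_erase_of_mem hsY, hYb]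
  set D := (F.slice a).filter fun A => A ⊆ U with hD
  have hDmem : ∀ A ∈ D, A ∈ F.slice a ∧ A ⊆ U := fun A hA => mem_filter.1 hA
  have hdiff : ∀ A ∈ D, (U \ A).card = 1 := fun A hA => by
    rw [card_sdiff_of_subset (hDmem A hA).2, (mem_slice.1 (hDmem A hA).1).2]; omega
  have hnot : Y.erase s ∉ D.image fun A => Y \ (U \ A) := by
    intro h
    obtain ⟨A, hA, hAe⟩ := mem_image.1 h
    have : s ∈ Y \ (U \ A) := mem_sdiff.2 ⟨hsY, fun h => hsU (mem_sdiff.1 h).1⟩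
    rw [hAe] at this
    exact notMem_erase s Y this
  have hinj : Set.InjOn (fun A => Y \ (U \ A)) (D : Set (Finset α)) := by
    intro A hA A' hA' h
    have h1 : ∀ A ∈ D, (Y \ (U \ A)) ∩ U = A := fun A hA => by
      ext x
      simp only [mem_inter, mem_sdiff]
      constructor
      · rintro ⟨⟨-, h2⟩, h3⟩; by_contra h4; exact h2 ⟨h3, h4⟩
      · exact fun h => ⟨⟨hUY ((hDmem A hA).2 h), fun h' => h'.2 h⟩, (hDmem A hA).2 h⟩
    rw [← h1 A hA, ← h1 A' hA']
    exact congrArg (· ∩ U) h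
  rw [← card_image_of_injOn hinj, ← card_insert_of_notMem hnot]
  refine card_le_card fun V hV => ?_
  rw [mem_filter, mem_slice]
  rcases mem_insert.1 hV with rfl | hV
  · refine ⟨⟨hfill X hX Y hY _ ?_ (erase_subset _ _) (by omega) (by omega), hVs⟩,
      erase_subset _ _⟩
    exact fun x hx => mem_erase.2 ⟨fun h => hsU (h ▸ hXU hx), hUY (hXU hx)⟩
  · obtain ⟨A, hA, rfl⟩ := mem_image.1 hV
    have hc : (Y \ (U \ A)).card = b - 1 := by
      rw [card_sdiff_of_subset (sdiff_subset.trans hUY), hdiff A hA, hYb]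
    refine ⟨⟨hfill A (hDmem A hA).1 Y hY _ ?_ sdiff_subset (by omega) (by omega), hc⟩,
      sdiff_subset⟩
    exact fun x hx => mem_sdiff.2 ⟨hUY ((hDmem A hA).2 hx), fun h => (mem_sdiff.1 h).2 hx⟩

/-- Two levels `a` and `b` of size at least `m` with all that lies between them cannot be joined by
only `m - 1` skipless chains that use up the levels `a + 1` and `b - 1`. -/
theorem false_of_filled {F G : Finset (Finset α)} {m a b : ℕ} (hab : a + 2 ≤ b)
    (hfill : ∀ X ∈ F.slice a, ∀ B ∈ F.slice b, ∀ Z, X ⊆ Z → Z ⊆ B → a < Z.card → Z.card < b →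
      Z ∈ F)
    (hGF : G ⊆ F) (hG : WidthLE (m - 1) G) (hGl : ∀ j, a ≤ j → j ≤ b → (G.slice j).card = m - 1)
    (hF1 : F.slice (a + 1) = G.slice (a + 1)) (hFb1 : F.slice (b - 1) = G.slice (b - 1))
    (hm : m - 1 < (F.slice a).card)
    (hup : ∀ X ∈ F.slice a, ∃ Y ∈ F.slice b, X ⊆ Y) : False := by
  obtain ⟨g, hg⟩ := hG.exists_isChainColoring
  have hsl : ∀ j, G.slice j ⊆ F.slice j := fun j => filter_subset_filter _ hGF
  have e1 : ∑ X ∈ F.slice a, ((F.slice (a + 1)).filter fun U => X ⊆ U).card =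
      ∑ U ∈ F.slice (a + 1), ((F.slice a).filter fun A => A ⊆ U).card :=
    sum_card_bipartiteAbove_eq_sum_card_bipartiteBelow (fun X U : Finset α => X ⊆ U)
  have e2 : ∑ V ∈ F.slice (b - 1), ((F.slice b).filter fun B => V ⊆ B).card =
      ∑ B ∈ F.slice b, ((F.slice (b - 1)).filter fun V => V ⊆ B).card :=
    sum_card_bipartiteAbove_eq_sum_card_bipartiteBelow (fun X U : Finset α => X ⊆ U)
  -- The `m - 1` chains of `G` map level `b - 1` injectively into level `a`, without lowering upper
  -- degrees. Some member of level `a` is missed and has positive upper degree, whence strictness.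
  have i1 : ∑ V ∈ F.slice (b - 1), ((F.slice b).filter fun B => V ⊆ B).card <
      ∑ X ∈ F.slice a, ((F.slice (a + 1)).filter fun U => X ⊆ U).card := by
    obtain ⟨φ, hφ, hφi⟩ := hg.exists_level_map (i := a) (j := b - 1) (hGl a le_rfl (by omega))
    obtain ⟨ψ, hψ, -⟩ := hg.exists_level_map (i := b) (j := b - 1) (hGl b (by omega) le_rfl)
    rw [← hFb1] at hφ hφi hψ
    have himg : (F.slice (b - 1)).image φ ⊆ F.slice a := fun X hX => by
      obtain ⟨V, hV, rfl⟩ := mem_image.1 hX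
      exact hsl a (hφ V hV).1
    obtain ⟨X₀, hX₀, hX₀n⟩ : ∃ X ∈ F.slice a, X ∉ (F.slice (b - 1)).image φ := by
      by_contra! hcon
      have h1 := card_le_card (show F.slice a ⊆ _ from hcon)
      have h2 := card_image_le (s := F.slice (b - 1)) (f := φ)
      rw [hFb1] at h1 h2
      have := hGl (b - 1) (by omega) (by omega)
      omega
    calc ∑ V ∈ F.slice (b - 1), ((F.slice b).filter fun B => V ⊆ B).card
        ≤ ∑ V ∈ F.slice (b - 1), ((F.slice (a + 1)).filter fun U => φ V ⊆ U).card := by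
          refine sum_le_sum fun V hV => ?_
          have hVc := (mem_slice.1 hV).2
          have := card_superset_succ_le hab hfill (hsl a (hφ V hV).1) (by omega)
            ((hφ V hV).2.1 (by omega)) (hsl b (hψ V hV).1) ((hψ V hV).2.2 (by omega))
          omega
      _ = ∑ X ∈ (F.slice (b - 1)).image φ, ((F.slice (a + 1)).filter fun U => X ⊆ U).card :=
          by rw [sum_image hφi]
      _ < ∑ X ∈ F.slice a, ((F.slice (a + 1)).filter fun U => X ⊆ U).card := by
          refine sum_lt_sum_of_subset himg hX₀ hX₀n ?_ fun _ _ _ => Nat.zero_le _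
          obtain ⟨Y, hY, hXY⟩ := hup X₀ hX₀
          have h1 := (mem_slice.1 hX₀).2
          have h2 := (mem_slice.1 hY).2
          obtain ⟨U, hXU, hUY, hU⟩ := exists_subsuperset_card_eq hXY
            (show X₀.card ≤ a + 1 by omega) (by omega)
          exact card_pos.2 ⟨U, mem_filter.2 ⟨mem_slice.2
            ⟨hfill X₀ hX₀ Y hY U hXU hUY (by omega) (by omega), hU⟩, hXU⟩⟩
  -- The dual count with lower degrees, against `i1`.
  have i2 : ∑ U ∈ F.slice (a + 1), ((F.slice a).filter fun A => A ⊆ U).card ≤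
      ∑ B ∈ F.slice b, ((F.slice (b - 1)).filter fun V => V ⊆ B).card := by
    obtain ⟨φ, hφ, hφi⟩ := hg.exists_level_map (i := b) (j := a + 1) (hGl b (by omega) le_rfl)
    obtain ⟨ψ, hψ, -⟩ := hg.exists_level_map (i := a) (j := a + 1) (hGl a le_rfl (by omega))
    rw [← hF1] at hφ hφi hψ
    have himg : (F.slice (a + 1)).image φ ⊆ F.slice b := fun X hX => by
      obtain ⟨V, hV, rfl⟩ := mem_image.1 hX
      exact hsl b (hφ V hV).1
    calc ∑ U ∈ F.slice (a + 1), ((F.slice a).filter fun A => A ⊆ U).card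
        ≤ ∑ U ∈ F.slice (a + 1), ((F.slice (b - 1)).filter fun V => V ⊆ φ U).card := by
          refine sum_le_sum fun U hU => ?_
          have := card_subset_succ_le hab hfill (hsl a (hψ U hU).1) (mem_slice.1 hU).2
            ((hψ U hU).2.1 (by omega)) (hsl b (hφ U hU).1) ((hφ U hU).2.2 (by omega))
          omega
      _ = ∑ B ∈ (F.slice (a + 1)).image φ, ((F.slice (b - 1)).filter fun V => V ⊆ B).card :=
          by rw [sum_image hφi]
      _ ≤ _ := sum_le_sum_of_subset himg
  omega

end Counting

/-! ### Replacing chains by skipless chains. -/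

section SkiplessChains

open Finset

variable {α : Type*} [DecidableEq α]

/-- Every family of width at most `m` whose lowest and highest levels have `m` members can be
enlarged to one of width at most `m` with `m` members on every level. Such a family
consists of `m` disjoint skipless chains. -/
def HasFullExtensions (α : Type*) (m : ℕ) : Prop :=
  ∀ (a b : ℕ) (F : Finset (Finset α)), a < b → (∀ S ∈ F, a ≤ S.card ∧ S.card ≤ b) →
    WidthLE m F → (F.slice a).card = m → (F.slice b).card = m →
    ∃ G, F ⊆ G ∧ (∀ S ∈ G, a ≤ S.card ∧ S.card ≤ b) ∧ WidthLE m G ∧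
      ∀ j, a ≤ j → j ≤ b → (G.slice j).card = m

/-- A family of width at most `m` that is maximal within the levels `a, …, b`. -/
structure IsSaturatedBetween (m a b : ℕ) (F : Finset (Finset α)) : Prop where
  levels : ∀ S ∈ F, a ≤ S.card ∧ S.card ≤ b
  width : WidthLE m F
  card_left : (F.slice a).card = m
  card_right : (F.slice b).card = m
  maximal : ∀ Z : Finset α, a ≤ Z.card → Z.card ≤ b → WidthLE m (insert Z F) → Z ∈ F

namespace IsSaturatedBetween

variable {m a b : ℕ} {F : Finset (Finset α)}

/-- The smaller case extends the chains with colours in `I` to a full system. With the other `m -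
I.card` chains it still has width at most `m`, so maximality puts every new set in `F` already. -/
theorem exists_subfamily (h : IsSaturatedBetween m a b F) (hab : a < b)
    (ih : ∀ m' < m, HasFullExtensions α m') {f : Finset α → ℕ} (hf : IsChainColoring m F f)
    {I : Finset ℕ} (hI : I ⊆ range m) (hIc : I.card < m) :
    ∃ G, (F.filter fun x => f x ∈ I) ⊆ G ∧ G ⊆ F ∧ WidthLE I.card G ∧
      ∀ j, a ≤ j → j ≤ b → (G.slice j).card = I.card := by
  have hsl : ∀ j, (F.slice j).card = m →
      ((F.filter fun x => f x ∈ I).slice j).card = I.card := fun j hj => by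
    rw [← hf.card_filter_mem slice_subset (isAntichain_slice F j) hj.ge hI]
    simp only [Finset.slice, filter_filter, and_comm]
  obtain ⟨G, hG1, hG2, hG3, hG4⟩ := ih I.card hIc a b (F.filter fun x => f x ∈ I) hab
    (fun S hS => h.levels S (mem_filter.1 hS).1) (hf.widthLE_filter I) (hsl a h.card_left)
    (hsl b h.card_right)
  refine ⟨G, hG1, fun Z hZ => h.maximal Z (hG2 Z hZ).1 (hG2 Z hZ).2 ?_, hG3, hG4⟩
  have h1 := hG3.union (hf.widthLE_filter (range m \ I))
  rw [card_sdiff_of_subset hI, card_range, Nat.add_sub_cancel' hIc.le] at h1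
  refine h1.mono (insert_subset (mem_union_left _ hZ) fun x hx => ?_)
  by_cases hxI : f x ∈ I
  · exact mem_union_left _ (hG1 (mem_filter.2 ⟨hx, hxI⟩))
  · exact mem_union_right _ (mem_filter.2 ⟨hx, mem_sdiff.2 ⟨mem_range.2 (hf.1 x hx), hxI⟩⟩)

theorem exists_card_slice_eq (h : IsSaturatedBetween m a b F) (hab : a + 2 ≤ b)
    (ih : ∀ m' < m, HasFullExtensions α m') : ∃ j, a < j ∧ j < b ∧ (F.slice j).card = m := by
  by_contra! hdef
  obtain ⟨f, hf⟩ := h.width.exists_isChainColoring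
  have hlt : ∀ j, a < j → j < b → (F.slice j).card < m := fun j h1 h2 =>
    lt_of_le_of_ne (h.width.card_slice_le j) (hdef j h1 h2)
  have hmpos : 0 < m := (Nat.zero_le _).trans_lt (hlt (a + 1) (by omega) (by omega))
  -- removing one chain
  have hrem : ∀ i < m, ∃ G, (F.filter fun x => f x ∈ (range m).erase i) ⊆ G ∧ G ⊆ F ∧
      WidthLE (m - 1) G ∧ (∀ j, a ≤ j → j ≤ b → (G.slice j).card = m - 1) ∧
      ∀ j, a < j → j < b → F.slice j = G.slice j := by
    intro i hi
    have hc : ((range m).erase i).card = m - 1 := by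
      rw [card_erase_of_mem (mem_range.2 hi), card_range]
    obtain ⟨G, h1, h2, h3, h4⟩ := h.exists_subfamily (by omega) ih hf (erase_subset i (range m))
      (by omega)
    rw [hc] at h3 h4
    refine ⟨G, h1, h2, h3, h4, fun j hj1 hj2 => ?_⟩
    refine (eq_of_subset_of_card_le (filter_subset_filter _ h2) ?_).symm
    have := hlt j hj1 hj2
    have := h4 j hj1.le hj2.le
    simp only [Finset.slice] at *
    omega
  -- antichains of size `m` live on the two extreme levels
  have hext : ∀ M ⊆ F, IsAntichain (· ≤ ·) (M : Set (Finset α)) → m ≤ M.card →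
      ∀ x ∈ M, x.card = a ∨ x.card = b := by
    intro M hM hMa hMc x hx
    obtain ⟨G, h1, h2, h3, h4, h5⟩ := hrem (f x) (hf.1 x (hM hx))
    obtain ⟨y, hy, hyG⟩ : ∃ y ∈ M, y ∉ G := by
      by_contra! hcon
      have := h3 M hcon hMa
      omega
    have hyF := hM hy
    have hyx : f y = f x := by
      by_contra hne
      exact hyG (h1 (mem_filter.2 ⟨hyF, mem_erase.2 ⟨hne, mem_range.2 (hf.1 y hyF)⟩⟩))
    rw [← hf.injOn hM hMa hy hx hyx]
    by_contra! hcon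
    have hl := h.levels y hyF
    have hyj : y ∈ F.slice y.card := mem_slice.2 ⟨hyF, rfl⟩
    rw [h5 y.card (by omega) (by omega)] at hyj
    exact hyG (mem_slice.1 hyj).1
  -- and do not mix the two levels
  have hmix : ∀ M ⊆ F, IsAntichain (· ≤ ·) (M : Set (Finset α)) → m ≤ M.card →
      ∀ x₀ ∈ M, ∀ y₀ ∈ M, x₀.card = a → y₀.card = b → False := by
    intro M hM hMa hMc x₀ hx₀ y₀ hy₀ hx₀a hy₀b
    set I := (M.filter fun x => x.card = a).image f with hIdef
    have hI : I ⊆ range m := fun i hi => by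
      obtain ⟨x, hx, rfl⟩ := mem_image.1 hi
      exact mem_range.2 (hf.1 x (hM (mem_filter.1 hx).1))
    have hmemI : ∀ x ∈ M, f x ∈ I → x.card = a := fun x hx hxI => by
      obtain ⟨y, hy, hyx⟩ := mem_image.1 hxI
      rw [← hf.injOn hM hMa (mem_filter.1 hy).1 hx hyx]
      exact (mem_filter.1 hy).2
    have hx₀I : f x₀ ∈ I := mem_image_of_mem f (mem_filter.2 ⟨hx₀, hx₀a⟩)
    have hy₀I : f y₀ ∉ I := fun hcon => by have := hmemI y₀ hy₀ hcon; omega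
    have hIlt : I.card < m := by
      have := card_lt_card (ssubset_iff_of_subset hI |>.2
        ⟨f y₀, mem_range.2 (hf.1 y₀ (hM hy₀)), hy₀I⟩)
      rwa [card_range] at this
    have hIpos : 0 < I.card := card_pos.2 ⟨_, hx₀I⟩
    have hIc : (range m \ I).card = m - I.card := by rw [card_sdiff_of_subset hI, card_range]
    obtain ⟨G, g1, g2, g3, g4⟩ := h.exists_subfamily (by omega) ih hf hI hIlt
    obtain ⟨H, h1, h2, h3, h4⟩ := h.exists_subfamily (by omega) ih hf
      (sdiff_subset (s := range m) (t := I)) (by omega)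
    -- `G` and `H` together have `m` members on level `a + 1`, where `F` has fewer, so they overlap.
    -- The common `z` links a bottom set with colour in `I` to a top set with colour outside `I`;
    -- both belong to `M`.
    obtain ⟨z, hzG, hzH⟩ : ∃ z, z ∈ G.slice (a + 1) ∧ z ∈ H.slice (a + 1) := by
      by_contra! hcon
      have h5 := card_union_of_disjoint (disjoint_left.2 hcon)
      have h6 := card_le_card (union_subset (filter_subset_filter (fun s => s.card = a + 1) g2)
        (filter_subset_filter (fun s => s.card = a + 1) h2))
      have h7 := hlt (a + 1) (by omega) (by omega)
      have h8 := g4 (a + 1) (by omega) (by omega)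
      have h9 := h4 (a + 1) (by omega) (by omega)
      simp only [Finset.slice] at *
      omega
    have hcolor : ∀ (J : Finset ℕ) (K : Finset (Finset α)) (j : ℕ), J ⊆ range m →
        (F.slice j).card = m → (F.filter fun x => f x ∈ J) ⊆ K → (K.slice j).card = J.card →
        ∀ x ∈ K.slice j, f x ∈ J := by
      intro J K j hJ hj hJK hK x hx
      have h5 : ((F.slice j).filter fun x => f x ∈ J) ⊆ K.slice j := fun y hy => by
        rw [mem_filter, mem_slice] at hy
        exact mem_slice.2 ⟨hJK (mem_filter.2 ⟨hy.1.1, hy.2⟩), hy.1.2⟩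
      have h6 := hf.card_filter_mem slice_subset (isAntichain_slice F j) hj.ge hJ
      rw [← eq_of_subset_of_card_le h5 (by omega)] at hx
      exact (mem_filter.1 hx).2
    rw [mem_slice] at hzG hzH
    obtain ⟨X, hX, hXz⟩ := g3.exists_slice_subset (g4 a le_rfl (by omega)) hzG.1 (by omega)
    obtain ⟨Y, hY, hzY⟩ := h3.exists_slice_superset (h4 b (by omega) le_rfl) hzH.1 (by omega)
    have hXI := hcolor I G a hI h.card_left g1 (g4 a le_rfl (by omega)) X hX
    have hYI := hcolor _ H b sdiff_subset h.card_right h1 (h4 b (by omega) le_rfl) Y hY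
    rw [mem_slice] at hX hY
    obtain ⟨x, hx, hxX⟩ := mem_image.1 hXI
    rw [mem_filter] at hx
    have hxX' : x = X := hf.eq_of_card_eq (hM hx.1) (g2 hX.1) hxX (by omega)
    rw [mem_sdiff, mem_range] at hYI
    obtain ⟨y, hy, hyY⟩ := hf.exists_mem hM hMa hMc hYI.1
    have hyb : y.card = b := (hext M hM hMa hMc y hy).resolve_left fun hya =>
      hYI.2 (by rw [← hyY]; exact mem_image_of_mem f (mem_filter.2 ⟨hy, hya⟩))
    have hyY' : y = Y := hf.eq_of_card_eq (hM hy) (h2 hY.1) hyY (by omega)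
    subst hxX' hyY'
    exact hMa hx.1 hy (fun h => by rw [h] at hx; omega) (hXz.trans hzY)
  -- An antichain of size `m + 1` through `Z` would leave all of level `a` or all of level `b`,
  -- hence `X` or `B`, which are comparable with `Z`.
  have hfill : ∀ X ∈ F.slice a, ∀ B ∈ F.slice b, ∀ Z, X ⊆ Z → Z ⊆ B → a < Z.card → Z.card < b →
      Z ∈ F := by
    intro X hX B hB Z hXZ hZB hZa hZb
    refine h.maximal Z hZa.le hZb.le fun M hM hMa => ?_
    by_contra! hcon
    have hZM : Z ∈ M := by
      by_contra hZM
      have := h.width M (fun x hx => (mem_insert.1 (hM hx)).resolve_left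
        fun h => hZM (h ▸ hx)) hMa
      omega
    have hM' : M.erase Z ⊆ F := fun x hx =>
      (mem_insert.1 (hM (mem_of_mem_erase hx))).resolve_left (ne_of_mem_erase hx)
    have hMa' : IsAntichain (· ≤ ·) ((M.erase Z : Finset (Finset α)) : Set (Finset α)) :=
      hMa.subset (by simp)
    have hc : m ≤ (M.erase Z).card := by rw [card_erase_of_mem hZM]; omega
    have hlev := hext _ hM' hMa' hc
    by_cases hall : ∀ x ∈ M.erase Z, x.card = a
    · have heq := eq_of_subset_of_card_le (s := M.erase Z) (t := F.slice a)
        (fun x hx => mem_slice.2 ⟨hM' hx, hall x hx⟩) (by rw [h.card_left]; exact hc)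
      rw [← heq] at hX
      exact hMa (mem_of_mem_erase hX) hZM (ne_of_mem_erase hX) hXZ
    · push Not at hall
      obtain ⟨y, hy, hya⟩ := hall
      have hyb := (hlev y hy).resolve_left hya
      have hall' : ∀ x ∈ M.erase Z, x.card = b := fun x hx =>
        (hlev x hx).resolve_left fun hxa => hmix _ hM' hMa' hc x hx y hy hxa hyb
      have heq := eq_of_subset_of_card_le (s := M.erase Z) (t := F.slice b)
        (fun x hx => mem_slice.2 ⟨hM' hx, hall' x hx⟩) (by rw [h.card_right]; exact hc)
      rw [← heq] at hB
      exact hMa hZM (mem_of_mem_erase hB) (ne_of_mem_erase hB).symm hZB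
  obtain ⟨G, -, h2, h3, h4, h5⟩ := hrem 0 hmpos
  exact false_of_filled hab hfill h2 h3 h4 (h5 _ (by omega) (by omega))
    (h5 _ (by omega) (by omega)) (by rw [h.card_left]; omega) fun X hX =>
      h.width.exists_slice_superset h.card_right (mem_slice.1 hX).1
        (by rw [(mem_slice.1 hX).2]; omega)

/-- The part of a saturated family between two full levels is saturated. -/
theorem restrict (h : IsSaturatedBetween m a b F) {a' b' : ℕ} (ha : a ≤ a') (hb : b' ≤ b)
    (hab : a' ≤ b') (ha' : (F.slice a').card = m) (hb' : (F.slice b').card = m) :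
    IsSaturatedBetween m a' b' (F.filter fun S => a' ≤ S.card ∧ S.card ≤ b') where
  levels S hS := (mem_filter.1 hS).2
  width := h.width.mono (filter_subset _ _)
  card_left := by
    rw [← ha']
    congr 1
    ext S
    simp only [mem_slice, mem_filter]
    exact ⟨fun h => ⟨h.1.1, h.2⟩, fun h => ⟨⟨h.1, by omega, by omega⟩, h.2⟩⟩
  card_right := by
    rw [← hb']
    congr 1
    ext S
    simp only [mem_slice, mem_filter]
    exact ⟨fun h => ⟨h.1.1, h.2⟩, fun h => ⟨⟨h.1, by omega, by omega⟩, h.2⟩⟩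
  maximal Z haZ hZb hZ := mem_filter.2 ⟨h.maximal Z (ha.trans haZ) (hZb.trans hb)
    (h.width.insert_of_insert_filter ha' hb' hab haZ hZb hZ), haZ, hZb⟩

/-- Between the nearest full levels around a deficient one the family is again saturated, so
`exists_card_slice_eq` yields a nearer full level. -/
theorem card_slice_eq (h : IsSaturatedBetween m a b F)
    (ih : ∀ m' < m, HasFullExtensions α m') {j : ℕ} (haj : a ≤ j) (hjb : j ≤ b) :
    (F.slice j).card = m := by
  by_contra hj
  obtain ⟨a', ha'⟩ := ((range j).filter fun i => a ≤ i ∧ (F.slice i).card = m).exists_maximal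
    ⟨a, mem_filter.2 ⟨mem_range.2 (lt_of_le_of_ne haj fun h' => hj (h' ▸ h.card_left)), le_rfl,
      h.card_left⟩⟩
  obtain ⟨b', hb'⟩ := ((range (b + 1)).filter fun i => j < i ∧ (F.slice i).card = m).exists_minimal
    ⟨b, mem_filter.2 ⟨mem_range.2 (by omega), lt_of_le_of_ne hjb fun h' => hj (h' ▸ h.card_right),
      h.card_right⟩⟩
  have h1 := ha'.1
  have h2 := hb'.1
  simp only [mem_filter, mem_range] at h1 h2
  obtain ⟨i, hi1, hi2, hi3⟩ := (h.restrict h1.2.1 (by omega : b' ≤ b) (by omega) h1.2.2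
    h2.2.2).exists_card_slice_eq (by omega) ih
  have hi : (F.slice i).card = m := by
    refine le_antisymm (h.width.card_slice_le i) ?_
    rw [← hi3]
    exact card_le_card (filter_subset_filter _ (filter_subset _ _))
  rcases lt_trichotomy i j with hij | rfl | hij
  · have := ha'.2 (mem_filter.2 ⟨mem_range.2 hij, by omega, hi⟩) hi1.le
    omega
  · exact hj hi
  · have := hb'.2 (mem_filter.2 ⟨mem_range.2 (by omega), hij, hi⟩) hi2.le
    omega

end IsSaturatedBetween

theorem hasFullExtensions [Fintype α] (m : ℕ) : HasFullExtensions α m := by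
  classical
  induction m using Nat.strong_induction_on with
  | _ m ih =>
  intro a b F hab hlev hw ha hb
  obtain ⟨G, hG⟩ := (univ.filter fun G : Finset (Finset α) => F ⊆ G ∧
    (∀ S ∈ G, a ≤ S.card ∧ S.card ≤ b) ∧ WidthLE m G).exists_maximal
    ⟨F, mem_filter.2 ⟨mem_univ _, subset_rfl, hlev, hw⟩⟩
  obtain ⟨-, hFG, hGl, hGw⟩ := mem_filter.1 hG.1
  have hfull : ∀ j, (F.slice j).card = m → (G.slice j).card = m := fun j hj =>
    le_antisymm (hGw.card_slice_le j) (hj ▸ card_le_card (filter_subset_filter _ hFG))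
  have hsat : IsSaturatedBetween m a b G :=
    { levels := hGl
      width := hGw
      card_left := hfull a ha
      card_right := hfull b hb
      maximal := fun Z haZ hZb hZ => hG.2 (y := insert Z G) (mem_filter.2 ⟨mem_univ _,
        hFG.trans (subset_insert _ _), fun S hS => by
          rcases mem_insert.1 hS with rfl | hS
          · exact ⟨haZ, hZb⟩
          · exact hGl S hS, hZ⟩) (subset_insert _ _) (mem_insert_self _ _) }
  exact ⟨G, hFG, hGl, hGw, fun j h1 h2 => hsat.card_slice_eq ih h1 h2⟩

end SkiplessChains

/-! ### Saturated families and the lower bound. -/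

section Saturated

open Finset

theorem not_containsAntichain_succ_iff {n m : ℕ} {F : Finset (Finset (Fin n))} :
    ¬ ContainsAntichain (m + 1) F ↔ WidthLE m F := by
  constructor
  · intro h M hM ha
    by_contra hlt
    obtain ⟨A, hA, hc⟩ := exists_subset_card_eq (show m + 1 ≤ M.card by omega)
    exact h ⟨A, hA.trans hM, hc, ha.subset (by simpa using hA)⟩
  · rintro h ⟨A, hA, hc, ha⟩
    have := h A hA ha
    omega

theorem isAntichainSaturated_succ_iff {n m : ℕ} {F : Finset (Finset (Fin n))} :
    IsAntichainSaturated (m + 1) F ↔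
      WidthLE m F ∧ ∀ X, WidthLE m (insert X F) → X ∈ F := by
  rw [IsAntichainSaturated, not_containsAntichain_succ_iff]
  refine and_congr_right fun _ => forall_congr' fun X => ?_
  rw [← not_containsAntichain_succ_iff]
  tauto

/-- The middle level of a cube of dimension `2 * t` inside the interval is an antichain. -/
theorem WidthLE.centralBinom_le {α : Type*} [DecidableEq α] {m t : ℕ} {F : Finset (Finset α)}
    (hF : WidthLE m F) {A B : Finset α} (hAB : A ⊆ B) (h : ∀ X, A ⊆ X → X ⊆ B → X ∈ F)
    (ht : A.card + 2 * t ≤ B.card) : Nat.centralBinom t ≤ m := by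
  obtain ⟨T, hT, hTc⟩ := exists_subset_card_eq
    (show 2 * t ≤ (B \ A).card by rw [card_sdiff_of_subset hAB]; omega)
  have hd : ∀ S ⊆ T, Disjoint A S := fun S hS =>
    disjoint_left.2 fun x hx hx' => (mem_sdiff.1 (hT (hS hx'))).2 hx
  have hinj : Set.InjOn (fun S => A ∪ S) (powersetCard t T : Set (Finset α)) := by
    intro S hS S' hS' hSS
    have h1 : ∀ S ⊆ T, (A ∪ S) \ A = S := fun S hS => by
      rw [union_sdiff_left, sdiff_eq_self_of_disjoint (hd S hS).symm]
    rw [← h1 S (mem_powersetCard.1 hS).1, ← h1 S' (mem_powersetCard.1 hS').1]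
    exact congrArg (· \ A) hSS
  have := hF ((powersetCard t T).image fun S => A ∪ S) (fun X hX => by
    obtain ⟨S, hS, rfl⟩ := mem_image.1 hX
    exact h _ subset_union_left (union_subset hAB
      (((mem_powersetCard.1 hS).1.trans hT).trans sdiff_subset))) (by
    refine (show Set.Sized (A.card + t) _ from fun X hX => ?_).isAntichain
    obtain ⟨S, hS, rfl⟩ := mem_image.1 (mem_coe.1 hX)
    rw [mem_powersetCard] at hS
    rw [card_union_of_disjoint (hd S hS.1), hS.2])
  rwa [card_image_of_injOn hinj, card_powersetCard, hTc, ← Nat.centralBinom_eq_two_mul_choose]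
    at this

/-- A saturated family that misses some set contains an antichain of the largest allowed size. -/
theorem exists_antichain_card_eq {α : Type*} [DecidableEq α] {m : ℕ} {F : Finset (Finset α)}
    (hsat : ∀ X, WidthLE m (insert X F) → X ∈ F) {X : Finset α} (hX : X ∉ F) :
    ∃ M ⊆ F, IsAntichain (· ≤ ·) (M : Set (Finset α)) ∧ m ≤ M.card := by
  have h1 : ¬ WidthLE m (insert X F) := fun h => hX (hsat X h)
  simp only [WidthLE] at h1
  push Not at h1
  obtain ⟨M, hM, hMa, hMc⟩ := h1
  refine ⟨M.erase X, fun x hx => (mem_insert.1 (hM (mem_of_mem_erase hx))).resolve_left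
    (ne_of_mem_erase hx), hMa.subset (by simp), ?_⟩
  have := pred_card_le_card_erase (s := M) (a := X)
  omega

section Blowup

variable {n : ℕ}

/-- The copy of `S` with `D` and `E` added on two disjoint copies of the ground set. -/
def blowup (S D E : Finset (Fin n)) : Finset (Fin n ⊕ (Fin n ⊕ Fin n)) :=
  S.disjSum (D.disjSum E)

theorem blowup_subset {S D E S' D' E' : Finset (Fin n)} :
    blowup S D E ⊆ blowup S' D' E' ↔ S ⊆ S' ∧ D ⊆ D' ∧ E ⊆ E' := by
  constructor
  · intro h
    refine ⟨fun x hx => ?_, fun x hx => ?_, fun x hx => ?_⟩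
    · simpa [blowup] using @h (Sum.inl x) (by simpa [blowup] using hx)
    · simpa [blowup] using @h (Sum.inr (Sum.inl x)) (by simpa [blowup] using hx)
    · simpa [blowup] using @h (Sum.inr (Sum.inr x)) (by simpa [blowup] using hx)
  · rintro ⟨h1, h2, h3⟩
    exact disjSum_mono h1 (disjSum_mono h2 h3)

theorem card_blowup (S D E : Finset (Fin n)) :
    (blowup S D E).card = S.card + D.card + E.card := by
  simp [blowup, add_assoc]

theorem toLeft_blowup (S D E : Finset (Fin n)) : (blowup S D E).toLeft = S := by
  simp [blowup]

theorem eq_blowup_of_subset {A B : Finset (Fin n)} {W : Finset (Fin n ⊕ (Fin n ⊕ Fin n))}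
    (hA : blowup A univ ∅ ⊆ W) (hB : W ⊆ blowup B univ ∅) : W = blowup W.toLeft univ ∅ := by
  ext x
  rcases x with x | x | x
  · simp [blowup]
  · simpa [blowup] using @hA (Sum.inr (Sum.inl x)) (by simp [blowup])
  · simpa [blowup] using fun h => by simpa [blowup] using @hB (Sum.inr (Sum.inr x)) h

/-- A saturated family is contained, up to a blow-up, in a family of skipless chains that start on
level `n` and end on level `2 * n`, and which has no further members in the original cube. -/
theorem exists_full_blowup {m : ℕ} (hn : 0 < n) {F : Finset (Finset (Fin n))}
    (hF : WidthLE m F) (hsat : ∀ X, WidthLE m (insert X F) → X ∈ F)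
    (hne : ∃ X, X ∉ F) :
    ∃ G : Finset (Finset (Fin n ⊕ (Fin n ⊕ Fin n))), WidthLE m G ∧
      (∀ S, S ∈ F ↔ blowup S univ ∅ ∈ G) ∧
      ∀ j, n ≤ j → j ≤ 2 * n → (G.slice j).card = m := by
  obtain ⟨f, hf⟩ := hF.exists_isChainColoring
  obtain ⟨X, hX⟩ := hne
  obtain ⟨M, hM, hMa, hMc⟩ := exists_antichain_card_eq hsat hX
  have hcl : ∀ i : Fin m, (F.filter fun S => f S = i).Nonempty := fun i => by
    obtain ⟨x, hx, hxi⟩ := hf.exists_mem hM hMa hMc i.2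
    exact ⟨x, mem_filter.2 ⟨hM hx, hxi⟩⟩
  -- `D` compensates for the size of `A`, so that `blowup A D ∅` lies exactly on level `n`.
  have hbot : ∀ i : Fin m, ∃ A D : Finset (Fin n), A ∈ F ∧ f A = i ∧ A.card + D.card = n ∧
      ∀ S ∈ F, f S = i → A ⊆ S := fun i => by
    obtain ⟨A, hA, hmin⟩ := exists_min_image _ card (hcl i)
    rw [mem_filter] at hA
    refine ⟨A, Aᶜ, hA.1, hA.2, by simp [card_add_card_compl], fun S hS hSi => ?_⟩
    exact hf.subset_of_card_le hA.1 hS (hA.2.trans hSi.symm) (hmin S (mem_filter.2 ⟨hS, hSi⟩))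
  have htop : ∀ i : Fin m, ∃ B E : Finset (Fin n), B ∈ F ∧ f B = i ∧ B.card + E.card = n ∧
      ∀ S ∈ F, f S = i → S ⊆ B := fun i => by
    obtain ⟨B, hB, hmax⟩ := exists_max_image _ card (hcl i)
    rw [mem_filter] at hB
    refine ⟨B, Bᶜ, hB.1, hB.2, by simp [card_add_card_compl], fun S hS hSi => ?_⟩
    exact hf.subset_of_card_le hS hB.1 (hSi.trans hB.2.symm) (hmax S (mem_filter.2 ⟨hS, hSi⟩))
  choose A D hAF hAi hAD hAmin using hbot
  choose B E hBF hBi hBE hBmax using htop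
  set K : Finset (Finset (Fin n ⊕ (Fin n ⊕ Fin n))) := F.image (fun S => blowup S univ ∅) ∪
    (univ.image (fun i => blowup (A i) (D i) ∅) ∪ univ.image (fun i => blowup (B i) univ (E i)))
    with hK
  have hKmem : ∀ W ∈ K, (∃ S ∈ F, W = blowup S univ ∅) ∨ (∃ i, W = blowup (A i) (D i) ∅) ∨
      ∃ i, W = blowup (B i) univ (E i) := by
    intro W hW
    simp only [hK, mem_union, mem_image, mem_univ, true_and] at hW
    rcases hW with ⟨S, hS, rfl⟩ | ⟨i, rfl⟩ | ⟨i, rfl⟩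
    · exact Or.inl ⟨S, hS, rfl⟩
    · exact Or.inr (Or.inl ⟨i, rfl⟩)
    · exact Or.inr (Or.inr ⟨i, rfl⟩)
  have hcol : IsChainColoring m K fun W => f W.toLeft := by
    constructor
    · intro W hW
      rcases hKmem W hW with ⟨S, hS, rfl⟩ | ⟨i, rfl⟩ | ⟨i, rfl⟩ <;>
        simp only [toLeft_blowup]
      · exact hf.1 S hS
      · exact hf.1 _ (hAF i)
      · exact hf.1 _ (hBF i)
    · intro W hW W' hW' h
      rcases hKmem W hW with ⟨S, hS, rfl⟩ | ⟨i, rfl⟩ | ⟨i, rfl⟩ <;>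
        rcases hKmem W' hW' with ⟨S', hS', rfl⟩ | ⟨i', rfl⟩ | ⟨i', rfl⟩ <;>
        simp only [toLeft_blowup, hAi, hBi] at h <;>
        simp only [blowup_subset, subset_univ, empty_subset, true_and, and_true, subset_rfl]
      · exact hf.2 S hS S' hS' h
      · exact Or.inr (hAmin i' S hS h)
      · exact Or.inl (hBmax i' S hS h)
      · exact Or.inl (hAmin i S' hS' h.symm)
      · rw [Fin.ext h]; simp
      · exact Or.inl (hAmin i _ (hBF i') ((hBi i').trans h.symm))
      · exact Or.inr (hBmax i S' hS' h.symm)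
      · exact Or.inr (hAmin i' _ (hBF i) ((hBi i).trans h))
      · rw [Fin.ext h]; simp
  have hlev : ∀ W ∈ K, n ≤ W.card ∧ W.card ≤ 2 * n := by
    intro W hW
    rcases hKmem W hW with ⟨S, hS, rfl⟩ | ⟨i, rfl⟩ | ⟨i, rfl⟩ <;>
      simp only [card_blowup, card_univ, Fintype.card_fin, card_empty]
    · have := card_le_univ S
      rw [Fintype.card_fin] at this
      omega
    · have := hAD i; omega
    · have := hBE i; omega
  have hcard : ∀ (j : ℕ) (w : Fin m → Finset (Fin n ⊕ (Fin n ⊕ Fin n))),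
      (∀ i, w i ∈ K.slice j) → (∀ i, f (w i).toLeft = i) → (K.slice j).card = m := by
    intro j w hw hwi
    refine le_antisymm (hcol.widthLE.card_slice_le j) ?_
    have hinj : Function.Injective w := fun i i' h => Fin.ext (by rw [← hwi, ← hwi, h])
    have := card_le_card (show univ.image w ⊆ K.slice j from fun W hW => by
      obtain ⟨i, -, rfl⟩ := mem_image.1 hW
      exact hw i)
    rwa [card_image_of_injective _ hinj, card_univ, Fintype.card_fin] at this
  obtain ⟨G, hKG, -, hGw, hGfull⟩ := hasFullExtensions m n (2 * n) K (by omega) hlev hcol.widthLE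
    (hcard n (fun i => blowup (A i) (D i) ∅) (fun i => mem_slice.2 ⟨mem_union_right _
      (mem_union_left _ (mem_image_of_mem _ (mem_univ i))), by simp [card_blowup, hAD]⟩)
      (fun i => by rw [toLeft_blowup, hAi]))
    (hcard (2 * n) (fun i => blowup (B i) univ (E i)) (fun i => mem_slice.2 ⟨mem_union_right _
      (mem_union_right _ (mem_image_of_mem _ (mem_univ i))), by
        have := hBE i
        simp only [card_blowup, card_univ, Fintype.card_fin]
        omega⟩)
      (fun i => by rw [toLeft_blowup, hBi]))
  have hFG : ∀ S ∈ F, blowup S univ ∅ ∈ G := fun S hS =>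
    hKG (mem_union_left _ (mem_image_of_mem _ hS))
  -- If the copy of `S` is in `G`, then `insert S F` embeds in `G`, so its width is at most `m` and
  -- saturation applies.
  refine ⟨G, hGw, fun S => ⟨hFG S, fun hS => hsat S fun M hM hMa => ?_⟩, hGfull⟩
  have hinj : Function.Injective fun S : Finset (Fin n) => blowup S univ ∅ := fun S S' h => by
    rw [← toLeft_blowup S univ ∅, ← toLeft_blowup S' univ ∅]
    exact congrArg toLeft h
  rw [← card_image_of_injective M hinj]
  refine hGw _ (fun W hW => ?_) ?_
  · obtain ⟨T, hT, rfl⟩ := mem_image.1 hW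
    rcases mem_insert.1 (hM hT) with rfl | hT
    · exact hS
    · exact hFG T hT
  · intro W hW W' hW' hne hle
    simp only [coe_image, Set.mem_image, mem_coe] at hW hW'
    obtain ⟨T, hT, rfl⟩ := hW
    obtain ⟨T', hT', rfl⟩ := hW'
    exact hMa hT hT' (fun h => hne (by rw [h])) (blowup_subset.1 hle).1

end Blowup

theorem card_slice_of_saturated {n m t : ℕ} (ht : m < Nat.centralBinom t) (hn : 2 * t ≤ n)
    (hn0 : 0 < n) {F : Finset (Finset (Fin n))} (hF : WidthLE m F)
    (hsat : ∀ X, WidthLE m (insert X F) → X ∈ F) {j : ℕ} (hj : 2 * t ≤ j)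
    (hjn : j + 2 * t ≤ n) : m ≤ (F.slice j).card := by
  have hne : ∃ X, X ∉ F := by
    by_contra! hall
    have := hF.centralBinom_le (A := ∅) (B := univ) (t := t) (subset_univ _)
      (fun X _ _ => hall X) (by simpa using hn)
    omega
  obtain ⟨G, hGw, hFG, hGfull⟩ := exists_full_blowup hn0 hF hsat hne
  obtain ⟨X, hX⟩ := hne
  obtain ⟨M, hM, hMa, hMc⟩ := exists_antichain_card_eq hsat hX
  obtain ⟨g, hg⟩ := hGw.exists_isChainColoring
  set h : Finset (Fin n) → ℕ := fun S => g (blowup S univ ∅) with hh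
  have hcol : IsChainColoring m F h :=
    ⟨fun S hS => hg.1 _ ((hFG S).1 hS), fun S hS T hT hST =>
      (hg.2 _ ((hFG S).1 hS) _ ((hFG T).1 hT) hST).imp (fun h => (blowup_subset.1 h).1)
        fun h => (blowup_subset.1 h).1⟩
  -- A set comparable with a whole chain can join it without raising the width. Thus all subsets of
  -- the least member and all supersets of the greatest are in `F`.
  have hadd : ∀ i < m, ∀ X, (∀ S ∈ F, h S = i → X ⊆ S ∨ S ⊆ X) → X ∈ F := by
    intro i hi X hX
    by_contra hXF
    have hne : ∀ S ∈ F, S ≠ X := fun S hS h => hXF (h ▸ hS)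
    refine hXF (hsat X (IsChainColoring.widthLE (f := fun S => if S = X then i else h S)
      ⟨fun S hS => ?_, fun S hS T hT hST => ?_⟩))
    · rcases mem_insert.1 hS with rfl | hS
      · simpa using hi
      · simpa [hne S hS] using hcol.1 S hS
    · rcases mem_insert.1 hS with rfl | hSF <;> rcases mem_insert.1 hT with rfl | hTF
      · exact Or.inl le_rfl
      · simp only [if_true, hne T hTF, if_false] at hST
        exact hX T hTF hST.symm
      · simp only [if_true, hne S hSF, if_false] at hST
        exact (hX S hSF hST).symm
      · simp only [hne S hSF, hne T hTF, if_false] at hST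
        exact hcol.2 S hSF T hTF hST
  have hex : ∀ i : Fin m, ∃ S ∈ F.slice j, h S = i := by
    intro i
    obtain ⟨x, hx, hxi⟩ := hcol.exists_mem hM hMa hMc i.2
    have hne : (F.filter fun S => h S = i).Nonempty := ⟨x, mem_filter.2 ⟨hM hx, hxi⟩⟩
    obtain ⟨A, hA, hmin⟩ := exists_min_image _ card hne
    obtain ⟨B, hB, hmax⟩ := exists_max_image _ card hne
    rw [mem_filter] at hA hB
    have hAS : ∀ S ∈ F, h S = i → A ⊆ S := fun S hS hSi => hcol.subset_of_card_le hA.1 hS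
      (hA.2.trans hSi.symm) (hmin S (mem_filter.2 ⟨hS, hSi⟩))
    have hBS : ∀ S ∈ F, h S = i → S ⊆ B := fun S hS hSi => hcol.subset_of_card_le hS hB.1
      (hSi.trans hB.2.symm) (hmax S (mem_filter.2 ⟨hS, hSi⟩))
    have hAc : A.card < 2 * t := by
      by_contra hcon
      have := hF.centralBinom_le (A := ∅) (B := A) (t := t) (empty_subset _)
        (fun X _ hXA => hadd i i.2 X fun S hS hSi => Or.inl (hXA.trans (hAS S hS hSi)))
        (by simp only [card_empty]; omega)
      omega
    have hBc : n < B.card + 2 * t := by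
      by_contra hcon
      have := hF.centralBinom_le (A := B) (B := univ) (t := t) (subset_univ _)
        (fun X hBX _ => hadd i i.2 X fun S hS hSi => Or.inr ((hBS S hS hSi).trans hBX))
        (by simp only [card_univ, Fintype.card_fin]; omega)
      omega
    -- The skipless chain has a member on level `n + j`; it lies between the copies of `A` and `B`,
    -- so it is the copy of a set in `F` of size `j`.
    obtain ⟨W, hW, hWi⟩ := hg.exists_mem_slice (hGfull (n + j) (by omega) (by omega)) i.2
    rw [mem_slice] at hW
    have hAW : blowup A univ ∅ ⊆ W := hg.subset_of_card_le ((hFG A).1 hA.1) hW.1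
      (hA.2.trans hWi.symm) (by
        simp only [card_blowup, card_univ, Fintype.card_fin, card_empty]; omega)
    have hWB : W ⊆ blowup B univ ∅ := hg.subset_of_card_le hW.1 ((hFG B).1 hB.1)
      (hWi.trans hB.2.symm) (by
        simp only [card_blowup, card_univ, Fintype.card_fin, card_empty]; omega)
    have hWe := eq_blowup_of_subset hAW hWB
    refine ⟨W.toLeft, mem_slice.2 ⟨(hFG _).2 (hWe ▸ hW.1), ?_⟩, ?_⟩
    · have := hW.2
      rw [hWe] at this
      simp only [card_blowup, card_univ, Fintype.card_fin, card_empty] at this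
      omega
    · rw [hh]; dsimp only; rw [← hWe, hWi]
  choose w hw hwi using hex
  have hinj : Function.Injective w := fun i i' h' => Fin.ext (by rw [← hwi, ← hwi, h'])
  have := card_le_card (show univ.image w ⊆ F.slice j from fun W hW => by
    obtain ⟨i, -, rfl⟩ := mem_image.1 hW
    exact hw i)
  rwa [card_image_of_injective _ hinj, card_univ, Fintype.card_fin] at this

theorem card_eq_sum_card_slice {n : ℕ} (F : Finset (Finset (Fin n))) :
    F.card = ∑ j ∈ range (n + 1), (F.slice j).card := by
  refine card_eq_sum_card_fiberwise fun S _ => ?_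
  have := card_le_univ S
  rw [Fintype.card_fin] at this
  simpa using Nat.lt_succ_of_le this

theorem mul_le_card_of_saturated {n m t : ℕ} (ht : m < Nat.centralBinom t) (hn : 4 * t ≤ n)
    (hn0 : 0 < n) {F : Finset (Finset (Fin n))} (hF : IsAntichainSaturated (m + 1) F) :
    m * n ≤ F.card + m * (4 * t) := by
  obtain ⟨hFw, hsat⟩ := isAntichainSaturated_succ_iff.1 hF
  have h1 : ∑ _j ∈ Ico (2 * t) (n + 1 - 2 * t), m ≤ ∑ j ∈ range (n + 1), (F.slice j).card :=
    (sum_le_sum fun j hj => card_slice_of_saturated ht (by omega) hn0 hFw hsat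
      (mem_Ico.1 hj).1 (by have := (mem_Ico.1 hj).2; omega)).trans
      (sum_le_sum_of_subset fun j hj => by
        have := (mem_Ico.1 hj).2
        exact mem_range.2 (by omega))
  rw [← card_eq_sum_card_slice, sum_const, Nat.card_Ico, smul_eq_mul] at h1
  have h2 : m * n ≤ (n + 1 - 2 * t - 2 * t) * m + m * (4 * t) := by
    rw [mul_comm _ m, ← mul_add]
    exact Nat.mul_le_mul_left m (by omega)
  omega

end Saturated

/-! ### A saturated family with thin low levels. -/

section UpperBound

open Finset

theorem two_pow_le_centralBinom (n : ℕ) : 2 ^ n ≤ Nat.centralBinom n := by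
  induction n with
  | zero => simp
  | succ n ih =>
    have h := Nat.succ_mul_centralBinom_succ n
    refine Nat.le_of_mul_le_mul_left (c := n + 1) ?_ (by omega)
    rw [h, pow_succ]
    nlinarith

theorem centralBinom_succ_le (n : ℕ) : Nat.centralBinom (n + 1) ≤ 4 * Nat.centralBinom n := by
  have h := Nat.succ_mul_centralBinom_succ n
  refine Nat.le_of_mul_le_mul_left (c := n + 1) ?_ (by omega)
  rw [h]
  nlinarith

theorem two_mul_choose_le {N j : ℕ} (h : 3 * j + 2 ≤ N) :
    2 * N.choose j ≤ N.choose (j + 1) := by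
  refine Nat.le_of_mul_le_mul_right (c := j + 1) ?_ (by omega)
  rw [Nat.choose_succ_right_eq, mul_right_comm, mul_comm, mul_comm 2]
  exact Nat.mul_le_mul_left _ (by omega)

theorem eight_mul_choose_le {t j : ℕ} (h : 3 * j + 8 ≤ 2 * t) :
    8 * (2 * t).choose j ≤ Nat.centralBinom t := by
  have h1 := two_mul_choose_le (N := 2 * t) (j := j) (by omega)
  have h2 := two_mul_choose_le (N := 2 * t) (j := j + 1) (by omega)
  have h3 := two_mul_choose_le (N := 2 * t) (j := j + 2) (by omega)
  have h4 := Nat.choose_le_centralBinom (j + 3) t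
  simp only [add_assoc, Nat.reduceAdd] at *
  omega

/-- Saturating an antichain on the middle level of a cube of dimension `2 * t` produces a saturated
family whose low levels are contained in that cube. -/
theorem exists_saturated_card_slice_le {n m t : ℕ} (hm : m ≤ Nat.centralBinom t)
    (hn : 2 * t ≤ n) : ∃ F : Finset (Finset (Fin n)), IsAntichainSaturated (m + 1) F ∧
      (∀ j, (F.slice j).card ≤ m) ∧ ∀ j < t, (F.slice j).card ≤ (2 * t).choose j := by
  classical
  obtain ⟨T, -, hT⟩ := exists_subset_card_eq (s := (univ : Finset (Fin n))) (n := 2 * t) (by simpa)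
  obtain ⟨M, hM, hMc⟩ := exists_subset_card_eq (s := powersetCard t T) (n := m)
    (by rwa [card_powersetCard, hT, ← Nat.centralBinom_eq_two_mul_choose])
  have hMa : IsAntichain (· ≤ ·) (M : Set (Finset (Fin n))) :=
    (show Set.Sized t _ from fun S hS => (mem_powersetCard.1 (hM hS)).2).isAntichain
  obtain ⟨F, hF⟩ := (univ.filter fun F : Finset (Finset (Fin n)) => M ⊆ F ∧
    WidthLE m F).exists_maximal ⟨M, mem_filter.2 ⟨mem_univ _, subset_rfl,
      fun A hA _ => hMc ▸ card_le_card hA⟩⟩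
  obtain ⟨-, hMF, hFw⟩ := mem_filter.1 hF.1
  refine ⟨F, isAntichainSaturated_succ_iff.2 ⟨hFw, fun X hX => hF.2 (y := insert X F)
    (mem_filter.2 ⟨mem_univ _, hMF.trans (subset_insert _ _), hX⟩) (subset_insert _ _)
    (mem_insert_self _ _)⟩, hFw.card_slice_le, fun j hj => ?_⟩
  rw [← hT, ← card_powersetCard]
  refine card_le_card fun X hX => ?_
  rw [mem_slice] at hX
  -- `M` is an antichain of the largest allowed size, so `X` is comparable with a member of it;
  -- being smaller, `X` lies inside that member.
  obtain ⟨S, hS, hSX⟩ := hFw.comparable hMF hMa hMc.ge hX.1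
  have hS' := mem_powersetCard.1 (hM hS)
  refine mem_powersetCard.2 ⟨?_, hX.2⟩
  rcases hSX with h | h
  · have := card_le_card h; omega
  · exact h.trans hS'.1

/-- Levels `1, …, J` have at most `m / 2` members each, since `8 * (2 * t).choose j ≤ centralBinom t
≤ 4 * centralBinom (t - 1) < 4 * m`. Levels `0` and `J + r + 1` have at most one, the other `r` at
most `m`. -/
theorem exists_saturated_card_le {m t J r : ℕ} (hm : m ≤ Nat.centralBinom t)
    (ht : Nat.centralBinom (t - 1) < m) (hJ : 3 * J + 8 ≤ 2 * t ∨ J = 0)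
    (hn : 2 * t ≤ J + r + 1) : ∃ F : Finset (Finset (Fin (J + r + 1))),
      IsAntichainSaturated (m + 1) F ∧ 2 * F.card + J * m ≤ 2 * (m * (J + r)) + 4 := by
  obtain ⟨F, hF, hFm, hFt⟩ := exists_saturated_card_slice_le hm hn
  refine ⟨F, hF, ?_⟩
  have hlow : ∀ j ∈ range J, 2 * (F.slice (j + 1)).card ≤ m := by
    intro j hj
    rw [mem_range] at hj
    have hJ' : 3 * J + 8 ≤ 2 * t := hJ.resolve_right (by omega)
    have h1 := hFt (j + 1) (by omega)
    have h2 := eight_mul_choose_le (t := t) (j := j + 1) (by omega)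
    have h3 := centralBinom_succ_le (t - 1)
    rw [Nat.sub_add_cancel (by omega)] at h3
    omega
  have h0 : (F.slice 0).card ≤ 1 := card_le_one.2 fun A hA B hB => by
    rw [mem_slice, card_eq_zero] at hA hB
    rw [hA.2, hB.2]
  have hlast : (F.slice (J + r + 1)).card ≤ 1 := card_le_one.2 fun A hA B hB => by
    have h : ∀ A ∈ F.slice (J + r + 1), A = univ := fun A hA => by
      rw [← card_eq_iff_eq_univ, (mem_slice.1 hA).2, Fintype.card_fin]
    rw [h A hA, h B hB]
  have h1 := sum_le_sum hlow
  have h2 : ∑ j ∈ range r, (F.slice (J + j + 1)).card ≤ ∑ _j ∈ range r, m :=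
    sum_le_sum fun j _ => hFm _
  rw [← mul_sum] at h1
  simp only [sum_const, card_range, smul_eq_mul] at h1 h2
  rw [card_eq_sum_card_slice, sum_range_succ, sum_range_succ', sum_range_add]
  nlinarith

end UpperBound

/-! ### Choice of parameters and constants. -/

theorem corollary1p1 :
    ∃ c₁ c₂ : ℝ, 0 < c₁ ∧ 0 < c₂ ∧
      ∀ k : ℕ, 4 ≤ k → ∃ N : ℕ, ∀ n : ℕ, N ≤ n →
        (n : ℝ) * ((k : ℝ) - 1) - c₁ * (k : ℝ) * Real.log (k : ℝ) ≤ (satStar n k : ℝ) ∧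
        (satStar n k : ℝ) ≤ (n : ℝ) * ((k : ℝ) - 1) - c₂ * (k : ℝ) * Real.log (k : ℝ) := by
  refine ⟨10, 1 / 96, by norm_num, by norm_num, fun k hk => ⟨4 * k, fun n hn => ?_⟩⟩
  obtain ⟨m, rfl⟩ : ∃ m, k = m + 1 := ⟨k - 1, by omega⟩
  have hleast := satStar_isLeast n (m + 1) (by omega)
  have hl2 := Real.log_two_gt_d9
  have hl2' := Real.log_two_lt_d9
  have hm3 : (3 : ℝ) ≤ m := by exact_mod_cast (by omega : 3 ≤ m)
  push_cast
  rw [add_sub_cancel_right]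
  have hlog4 : 2 * Real.log 2 ≤ Real.log (m + 1) := by
    rw [← Real.log_rpow (by norm_num)]
    exact Real.log_le_log (by norm_num) (by norm_num; linarith)
  constructor
  · obtain ⟨F, hF, hFc⟩ := hleast.1
    rw [← hFc]
    have hlt : m < Nat.centralBinom (Nat.log 2 m + 1) :=
      (Nat.lt_pow_succ_log_self (by norm_num) m).trans_le (two_pow_le_centralBinom _)
    have hle : Nat.log 2 m ≤ m := Nat.log_le_self 2 m
    have h := mul_le_card_of_saturated hlt (by omega) (by omega) hF
    have hR : (m : ℝ) * n ≤ F.card + m * (4 * ((Nat.log 2 m : ℝ) + 1)) := by exact_mod_cast h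
    have hlogm : (Nat.log 2 m : ℝ) * Real.log 2 ≤ Real.log (m + 1) := by
      rw [← Real.log_pow]
      refine Real.log_le_log (by positivity) ?_
      have : 2 ^ Nat.log 2 m ≤ m := Nat.pow_log_le_self 2 (by omega)
      have : (2 : ℝ) ^ Nat.log 2 m ≤ m := by exact_mod_cast this
      linarith
    -- Here `3 / (2 * log 2) < 5 / 2`; the loss of `4 * t` levels then gives the constant `10`.
    have ht : (Nat.log 2 m : ℝ) + 1 ≤ 5 / 2 * Real.log (m + 1) := by
      have : (0 : ℝ) ≤ Nat.log 2 m := Nat.cast_nonneg _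
      nlinarith
    have h5 : (m : ℝ) * (4 * ((Nat.log 2 m : ℝ) + 1)) ≤ 10 * (m + 1) * Real.log (m + 1) := by
      nlinarith
    linarith
  · have hex : ∃ t, m ≤ Nat.centralBinom t :=
      ⟨m, Nat.lt_two_pow_self.le.trans (two_pow_le_centralBinom m)⟩
    obtain ⟨t, ht, htmin⟩ : ∃ t, m ≤ Nat.centralBinom t ∧ ∀ s < t, Nat.centralBinom s < m := by
      classical
      exact ⟨Nat.find hex, Nat.find_spec hex, fun s hs => not_le.1 (Nat.find_min hex hs)⟩
    have htpos : 0 < t := by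
      by_contra h0
      rw [Nat.eq_zero_of_not_pos h0, Nat.centralBinom_zero] at ht
      omega
    have htm : t ≤ m := by
      by_contra hlt
      have := htmin m (by omega)
      have := (Nat.lt_two_pow_self (n := m)).le.trans (two_pow_le_centralBinom m)
      omega
    obtain ⟨J, hJ, hJt, hJ2⟩ : ∃ J, (3 * J + 8 ≤ 2 * t ∨ J = 0) ∧ t ≤ 8 + 12 * J ∧ J ≤ t :=
      ⟨(2 * t - 8) / 3, by omega, by omega, by omega⟩
    obtain ⟨r, rfl⟩ : ∃ r, n = J + r + 1 := ⟨n - J - 1, by omega⟩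
    obtain ⟨F, hF, hFc⟩ := exists_saturated_card_le (r := r) ht
      (htmin (t - 1) (by omega)) hJ (by omega)
    have hs : (satStar (J + r + 1) (m + 1) : ℝ) ≤ F.card := by
      exact_mod_cast hleast.2 ⟨F, hF, rfl⟩
    have hR : 2 * (F.card : ℝ) + J * m ≤ 2 * (m * (J + r)) + 4 := by exact_mod_cast hFc
    have hlog : Real.log (m + 1) ≤ 3 * t := by
      have h4 : (m : ℝ) + 1 ≤ 2 ^ (4 * t) := by
        have h5 : m + 1 ≤ 2 ^ (4 * t) := by
          have h6 := ht.trans (Nat.centralBinom_le_four_pow t)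
          have h7 : 2 ^ (4 * t) = 4 ^ t * 4 ^ t := by
            rw [← mul_pow, pow_mul]; norm_num
          have h8 : 4 ≤ 4 ^ t := Nat.le_self_pow (by omega) 4
          rw [h7]
          nlinarith
        exact_mod_cast h5
      have h9 := Real.log_le_log (by positivity) h4
      rw [Real.log_pow] at h9
      push_cast at h9
      have : (0 : ℝ) < t := by exact_mod_cast htpos
      nlinarith
    have hJR : (t : ℝ) ≤ 8 + 12 * J := by exact_mod_cast hJt
    have hJ0 : (0 : ℝ) ≤ J := Nat.cast_nonneg _
    -- The saving to be matched is `(m - 2) + J * m / 2`, whose first term covers the case `J = 0`.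
    -- It dominates the right-hand side, `(m + 1) / 4 + 3 * J * (m + 1) / 8`, exactly from `m = 3`
    -- on, that is, for `k ≥ 4`.
    have h1 : 1 / 96 * ((m : ℝ) + 1) * Real.log (m + 1) ≤ 1 / 32 * (m + 1) * (8 + 12 * J) := by
      nlinarith
    push_cast
    nlinarith
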